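/- Let $G$ be a discrete (left) amenable semigroup, not assumed to be countable, cancellative or unital. A left-invariant mean on $G$ is a continuous linear functional $m:\ell^\infty(G)\to\mathbb C$ such that $m({}_gf)=m(f)$ for all $g\in G$ and $f\in\ell^\infty(G)$, where ${}_gf(x)=f(gx)$; $m(f)\ge 0$ for every bounded $f:G\to[0,\infty)$; and $m(\mathbb 1_G)=1$. For a subset $S$ of a set $Y$ write $S^1=S$ and $S^0=Y\setminus S$, and for $S\subseteq G$ and $g\in G$ write $g^{-1}S=\{x\in G: gx\in S\}$. Let $E\subseteq G$ be such that $m(\mathbb 1_E)>0$ for some left-invariant mean $m$ on $G$. Then there exist a left-invariant mean $\tilde m$ on $G$, an ergodic measure-preserving system $(X,\mathcal B,\mu,(T_g)_{g\in G})$ and a set $A\in\mathcal B$ such that $$0<m(\mathbb 1_E)\le\tilde m(\mathbb 1_E)=\mu(A)$$ and, for every $k\ge 0$, all $g_1,\dots,g_k\in G$ and all $w_0,\dots,w_k\in\{0,1\}$, $$\tilde m\bigl(\mathbb 1_{E^{w_0}\star g_1^{-1}E^{w_1}\star\cdots\star g_k^{-1}E^{w_k}}\bigr)=\mu\bigl(A^{w_0}\star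 T_{g_1}^{-1}A^{w_1}\star\cdots\star T_{g_k}^{-1}A^{w_k}\bigr),$$ where each $\star$ denotes either $\cup$ or $\cap$, and the choices of operations and of parentheses are arbitrary but the same on both sides. More generally, the same equality holds for every finite parenthesized expression in $\cup$ and $\cap$ whose terms are of the form $E^{w}$ or $g^{-1}E^{w}$ (in any order and with repetitions), with $A^{w}$ and $T_g^{-1}A^{w}$ as the corresponding terms on the right. Here an ergodic measure-preserving system $(X,\mathcal B,\mu,(T_g)_{g\in G})$ consists of a probability space $(X,\mathcal B,\mu)$ and measurable, $\mu$-preserving maps $T_g:X\to X$ with $T_{gh}=T_g\circ T_h$ for all $g,h\in G$ (and $T_e=\mathrm{id}_X$ if $G$ has an identity element $e$), such that every $B\in\mathcal B$ with $\mu(T_g^{-1}B\,\triangle\,B)=0$ for all $g\in G$ satisfies $\mu(B)\in\{0,1\}$. -/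

import Mathlib

open scoped ENNReal ComplexOrder

universe u

/-- The space `ℓ^∞(G)` of bounded complex-valued functions on `G`. -/
abbrev EllInfty (G : Type*) : Type _ := lp (fun _ : G => ℂ) ∞

/-- The indicator function of `E`, as an element of `ℓ^∞(G)`. -/
noncomputable def EllInfty.indicator {G : Type*} (E : Set G) : EllInfty G :=
  ⟨E.indicator (fun _ => (1 : ℂ)), memℓp_infty_iff.2 ⟨1, by
    rintro _ ⟨x, rfl⟩
    by_cases hx : x ∈ E <;> simp [hx]⟩⟩

/-- The left translate `x ↦ f (g * x)` of `f ∈ ℓ^∞(G)`. -/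
def EllInfty.leftTranslate {G : Type*} [Semigroup G] (g : G) (f : EllInfty G) : EllInfty G :=
  ⟨fun x => f (g * x), memℓp_infty_iff.2 (by
    obtain ⟨C, hC⟩ := memℓp_infty_iff.1 (lp.memℓp f)
    refine ⟨C, ?_⟩
    rintro _ ⟨x, rfl⟩
    exact hC ⟨g * x, rfl⟩)⟩

/-- `m` is a left-invariant mean on the discrete semigroup `G`. -/
structure IsLeftInvariantMean {G : Type*} [Semigroup G] (m : EllInfty G →L[ℂ] ℂ) : Prop where
  invariant : ∀ (g : G) (f : EllInfty G), m (EllInfty.leftTranslate g f) = m f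
  nonneg : ∀ f : EllInfty G, (∀ x : G, 0 ≤ f x) → 0 ≤ m f
  normalized : m (EllInfty.indicator Set.univ) = 1

/-- `signed S w` is `S` for `w = 1` and the complement of `S` for `w = 0`. -/
def signed {Y : Type*} (S : Set Y) (w : Bool) : Set Y :=
  if w then S else Sᶜ

/-- Fully parenthesized formal expressions built with `∪` and `∩` from the symbols
`S^w` and `g⁻¹ S^w`, where `g ∈ G` and `w ∈ {0, 1}`. -/
inductive StarExpr (G : Type*) where
  | base (w : Bool) : StarExpr G
  | translate (g : G) (w : Bool) : StarExpr G
  | union (a b : StarExpr G) : StarExpr G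
  | inter (a b : StarExpr G) : StarExpr G

/-- The value of an expression at a set `S ⊆ Y`, where `g⁻¹ S^w` is read as the preimage of
`S^w` under the map `T g : Y → Y`. -/
def StarExpr.eval {G Y : Type*} (T : G → Y → Y) (S : Set Y) : StarExpr G → Set Y
  | .base w => signed S w
  | .translate g w => T g ⁻¹' signed S w
  | .union a b => a.eval T S ∪ b.eval T S
  | .inter a b => a.eval T S ∩ b.eval T S

/-! Means restrict to invariant finitely additive charges on subsets of `G`. These form a compact
convex set (`isCompact`), so by Krein–Milman some extreme charge `ν` maximises the value at `E`
(`exists_extremePoint_le`). Passing to ultrafilters, `S ↦ hat S` is an equivariant embedding of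
Boolean algebras, and compactness makes `ν` countably additive there (`exists_measure`). Extremality
of `ν` becomes ergodicity of the measure (`ergodicSMul`). With `A = hat E`, and integration of the
continuous extensions of bounded functions as the new mean, every identity reduces to `hat_eval`. -/

open MeasureTheory Filter Topology

/-! ### The space of ultrafilters as a measurable `G`-space -/

namespace Ultrafilter

variable {G : Type*}

/-- The clopen set of ultrafilters on `G` that contain `S`. -/
def hat (S : Set G) : Set (Ultrafilter G) := {U | S ∈ U}

@[simp] lemma mem_hat {S : Set G} {U : Ultrafilter G} : U ∈ hat S ↔ S ∈ U := Iff.rfl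

@[simp] lemma hat_univ : hat (Set.univ : Set G) = Set.univ :=
  Set.eq_univ_of_forall fun _ => univ_mem

@[simp] lemma hat_empty : hat (∅ : Set G) = ∅ := by
  ext U; simp

lemma hat_compl (S : Set G) : hat Sᶜ = (hat S)ᶜ := by
  ext U; simp [compl_mem_iff_notMem]

lemma hat_union (S T : Set G) : hat (S ∪ T) = hat S ∪ hat T := by
  ext U; simp [union_mem_iff]

lemma hat_inter (S T : Set G) : hat (S ∩ T) = hat S ∩ hat T :=
  Set.ext fun _ => inter_mem_iff

lemma pure_preimage_hat (S : Set G) : (pure : G → Ultrafilter G) ⁻¹' hat S = S := by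
  ext x; simp

/-- The `σ`-algebra on the space of ultrafilters generated by the clopen sets `hat S`. -/
instance instMeasurableSpace : MeasurableSpace (Ultrafilter G) :=
  MeasurableSpace.generateFrom (Set.range hat)

lemma measurableSet_hat (S : Set G) : MeasurableSet (hat S) :=
  MeasurableSpace.measurableSet_generateFrom ⟨S, rfl⟩

lemma isSetAlgebra_range_hat : IsSetAlgebra (Set.range (hat : Set G → Set (Ultrafilter G))) where
  empty_mem := ⟨∅, hat_empty⟩
  compl_mem := by rintro _ ⟨S, rfl⟩; exact ⟨Sᶜ, hat_compl S⟩
  union_mem := by rintro _ _ ⟨S, rfl⟩ ⟨T, rfl⟩; exact ⟨S ∪ T, hat_union S T⟩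

lemma isPiSystem_range_hat : IsPiSystem (Set.range (hat : Set G → Set (Ultrafilter G))) :=
  fun _ hs _ ht _ => isSetAlgebra_range_hat.inter_mem hs ht

/-- A semigroup acts on the ultrafilters on it by pushforward under left translation. -/
instance instSemigroupAction [Semigroup G] : SemigroupAction G (Ultrafilter G) where
  smul g U := U.map (g * ·)
  mul_smul g h U := by
    change U.map _ = (U.map _).map _
    rw [map_map]
    congr 1
    ext x
    exact mul_assoc g h x

lemma smul_def [Semigroup G] (g : G) (U : Ultrafilter G) : g • U = U.map (g * ·) := rfl

lemma preimage_smul_hat [Semigroup G] (g : G) (S : Set G) :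
    (fun U : Ultrafilter G => g • U) ⁻¹' hat S = hat ((g * ·) ⁻¹' S) := by
  ext U; simp [smul_def]

instance instMeasurableConstSMul [Semigroup G] : MeasurableConstSMul G (Ultrafilter G) where
  measurable_const_smul g := by
    refine measurable_generateFrom ?_
    rintro _ ⟨S, rfl⟩
    rw [preimage_smul_hat]
    exact measurableSet_hat _

lemma hat_eval [Semigroup G] (E : Set G) (c : StarExpr G) :
    hat (c.eval (fun g x => g * x) E) =
      c.eval (fun (g : G) (U : Ultrafilter G) => g • U) (hat E) := by
  have hsigned (w : Bool) : hat (signed E w) = signed (hat E) w := by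
    cases w <;> simp [signed, hat_compl]
  induction c with
  | base w => exact hsigned w
  | translate g w =>
    simp only [StarExpr.eval]
    rw [← hsigned, preimage_smul_hat]
  | union a b ha hb => simp only [StarExpr.eval, hat_union, ha, hb]
  | inter a b ha hb => simp only [StarExpr.eval, hat_inter, ha, hb]

/-- A finite measure on the space of ultrafilters is determined by its values on clopen sets. -/
lemma measure_ext_hat {μ ν : Measure (Ultrafilter G)} [IsFiniteMeasure μ]
    (h : ∀ S, μ (hat S) = ν (hat S)) : μ = ν := by
  refine ext_of_generate_finite _ rfl isPiSystem_range_hat ?_ ?_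
  · rintro _ ⟨S, rfl⟩; exact h S
  · simpa using h Set.univ

/-- If `f` converges along every ultrafilter, then its limit is a measurable function. -/
lemma measurable_of_tendsto {f : G → ℝ} {F : Ultrafilter G → ℝ}
    (h : ∀ U : Ultrafilter G, Tendsto f U (𝓝 (F U))) : Measurable F := by
  refine measurable_of_Ioi fun a => ?_
  -- The union must be countable: the `σ`-algebra is generated by clopen sets only, so openness of
  -- the preimage would not suffice.
  have : F ⁻¹' Set.Ioi a = ⋃ n : ℕ, hat {x | a + 1 / ((n : ℝ) + 1) ≤ f x} := by
    ext U
    simp only [Set.mem_preimage, Set.mem_Ioi, Set.mem_iUnion, mem_hat]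
    constructor
    · intro hU
      obtain ⟨n, hn⟩ := exists_nat_one_div_lt (sub_pos.2 hU)
      refine ⟨n, ?_⟩
      filter_upwards [(h U).eventually_const_le (u := a + 1 / ((n : ℝ) + 1)) (by linarith)]
        with x hx using hx
    · rintro ⟨n, hn⟩
      have := ge_of_tendsto (h U) hn
      have : (0 : ℝ) < 1 / ((n : ℝ) + 1) := by positivity
      linarith
  rw [this]
  exact MeasurableSet.iUnion fun n => measurableSet_hat _

end Ultrafilter

/-! ### Invariant charges, their extreme points and ergodicity -/

open Ultrafilter

/-- The finitely additive, left-invariant probability charges on the subsets of `G`. -/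
def invariantCharges (G : Type*) [Semigroup G] : Set (Set G → ℝ) :=
  {ν | (∀ S, 0 ≤ ν S) ∧ ν Set.univ = 1 ∧ (∀ S T, Disjoint S T → ν (S ∪ T) = ν S + ν T) ∧
    ∀ (g : G) (S), ν ((g * ·) ⁻¹' S) = ν S}

namespace invariantCharges

variable {G : Type*} [Semigroup G]

lemma apply_empty {ν : Set G → ℝ} (hν : ν ∈ invariantCharges G) : ν ∅ = 0 := by
  have := hν.2.2.1 ∅ ∅ (by simp)
  simpa using this

/-- Each defining condition involves finitely many coordinates and is closed, and all values lie in
`[0, 1]`, so Tychonoff applies. -/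
lemma isCompact : IsCompact (invariantCharges G) := by
  refine IsCompact.of_isClosed_subset
    (isCompact_univ_pi fun _ : Set G => isCompact_Icc (a := (0 : ℝ)) (b := 1)) ?_ ?_
  · simp only [invariantCharges, Set.ofPred_and, Set.ofPred_forall]
    refine (isClosed_iInter fun S => ?_).inter (IsClosed.inter ?_ (IsClosed.inter ?_ ?_))
    · exact isClosed_le (by fun_prop) (by fun_prop)
    · exact isClosed_eq (by fun_prop) (by fun_prop)
    · exact isClosed_iInter fun S => isClosed_iInter fun T => isClosed_iInter fun _ =>
        isClosed_eq (by fun_prop) (by fun_prop)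
    · exact isClosed_iInter fun g => isClosed_iInter fun S =>
        isClosed_eq (by fun_prop) (by fun_prop)
  · intro ν hν S _
    refine ⟨hν.1 S, ?_⟩
    have := hν.2.2.1 S Sᶜ disjoint_compl_right
    rw [Set.union_compl_self, hν.2.1] at this
    linarith [hν.1 Sᶜ]

/-- Some extreme invariant charge has the largest possible value at a given set. -/
lemma exists_extremePoint_le {ν₀ : Set G → ℝ} (hν₀ : ν₀ ∈ invariantCharges G) (E : Set G) :
    ∃ ν ∈ (invariantCharges G).extremePoints ℝ, ν₀ E ≤ ν E := by
  let l : StrongDual ℝ (Set G → ℝ) := ContinuousLinearMap.proj E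
  -- The maximisers at `E` form a compact exposed face, whose extreme points are extreme in the
  -- whole set.
  have h : IsExposed ℝ (invariantCharges G)
    {ν ∈ invariantCharges G | ∀ ρ ∈ invariantCharges G, l ρ ≤ l ν} := fun _ => ⟨l, rfl⟩
  obtain ⟨z, hz, hzmax⟩ := isCompact.exists_isMaxOn ⟨ν₀, hν₀⟩ l.continuous.continuousOn
  obtain ⟨ν, hν⟩ := (h.isCompact isCompact).extremePoints_nonempty ⟨z, hz, hzmax⟩
  exact ⟨ν, h.isExtreme.extremePoints_subset_extremePoints hν, hν.1.2 ν₀ hν₀⟩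

/-- A charge on `G` extends to a measure on the space of ultrafilters. -/
lemma exists_measure {ν : Set G → ℝ} (hν : ν ∈ invariantCharges G) :
    ∃ μ : Measure (Ultrafilter G), ∀ S, μ (hat S) = ENNReal.ofReal (ν S) := by
  have hR := (isSetAlgebra_range_hat (G := G)).isSetRing
  let m : AddContent ℝ≥0∞ (Set.range (hat : Set G → Set (Ultrafilter G))) :=
    hR.addContent_of_union (fun B => ENNReal.ofReal (ν (pure ⁻¹' B)))
      (by simp [apply_empty hν]) (by
        intro s t _ _ hst
        rw [Set.preimage_union, hν.2.2.1 _ _ (hst.preimage _),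
          ENNReal.ofReal_add (hν.1 _) (hν.1 _)])
  have hm (S : Set G) : m (hat S) = ENNReal.ofReal (ν S) := by
    change ENNReal.ofReal (ν (pure ⁻¹' hat S)) = _
    rw [pure_preimage_hat]
  -- A clopen union of countably many clopen sets is already a finite subunion, by compactness.
  have hsub : m.IsSigmaSubadditive := by
    intro f hf hU
    have hcomp : IsCompact (⋃ i, f i) := by
      obtain ⟨S, hS⟩ := hU
      rw [← hS]
      exact (ultrafilter_isClosed_basic S).isCompact
    obtain ⟨t, ht⟩ := hcomp.elim_finite_subcover f (fun i => by
      obtain ⟨S, hS⟩ := hf i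
      rw [← hS]
      exact ultrafilter_isOpen_basic S) subset_rfl
    have heq : ⋃ i, f i = ⋃ i ∈ t, f i :=
      ht.antisymm (Set.iUnion₂_subset fun i _ => Set.subset_iUnion f i)
    rw [heq]
    exact (addContent_biUnion_le hR fun i _ => hf i).trans (ENNReal.sum_le_tsum t)
  refine ⟨m.measure hR.isSetSemiring le_rfl hsub, fun S => ?_⟩
  rw [m.measure_eq hR.isSetSemiring rfl hsub ⟨S, rfl⟩, hm]

section Measure

variable {ν : Set G → ℝ} {μ : Measure (Ultrafilter G)}

lemma isProbabilityMeasure (hν : ν ∈ invariantCharges G)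
    (hμ : ∀ S, μ (hat S) = ENNReal.ofReal (ν S)) : IsProbabilityMeasure μ := by
  constructor
  rw [← hat_univ, hμ, hν.2.1, ENNReal.ofReal_one]

lemma measureReal_hat (hν : ν ∈ invariantCharges G)
    (hμ : ∀ S, μ (hat S) = ENNReal.ofReal (ν S)) (S : Set G) : μ.real (hat S) = ν S := by
  rw [measureReal_def, hμ, ENNReal.toReal_ofReal (hν.1 S)]

lemma smulInvariantMeasure (hν : ν ∈ invariantCharges G)
    (hμ : ∀ S, μ (hat S) = ENNReal.ofReal (ν S)) : SMulInvariantMeasure G (Ultrafilter G) μ := by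
  have := isProbabilityMeasure hν hμ
  constructor
  intro g s hs
  have hmeas : Measurable fun U : Ultrafilter G => g • U := measurable_const_smul g
  have hmap : μ = μ.map fun U : Ultrafilter G => g • U := by
    refine measure_ext_hat fun S => ?_
    rw [Measure.map_apply hmeas (measurableSet_hat S), preimage_smul_hat, hμ, hμ, hν.2.2.2]
  rw [← Measure.map_apply hmeas hs, ← hmap]

/-- Conditioning an invariant measure on an invariant set gives an invariant charge. -/
lemma cond_mem [IsProbabilityMeasure μ] [SMulInvariantMeasure G (Ultrafilter G) μ]
    {B : Set (Ultrafilter G)} (hB : MeasurableSet B) (hBμ : μ.real B ≠ 0)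
    (hinv : ∀ g : G, (g • ·) ⁻¹' B =ᵐ[μ] B) :
    (fun S => (μ.real B)⁻¹ * μ.real (hat S ∩ B)) ∈ invariantCharges G := by
  refine ⟨fun S => by positivity, by simp [hBμ], fun S T hST => ?_, fun g S => ?_⟩
  · have hdisj : Disjoint (hat S) (hat T) := by
      rw [Set.disjoint_iff_inter_eq_empty] at hST ⊢
      rw [← hat_inter, hST, hat_empty]
    simp only
    rw [hat_union, Set.union_inter_distrib_right, ← mul_add]
    congr 1
    rw [← measureReal_restrict_apply (measurableSet_hat S),
      ← measureReal_restrict_apply (measurableSet_hat T), ← Set.union_inter_distrib_right,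
      ← measureReal_restrict_apply ((measurableSet_hat S).union (measurableSet_hat T)),
      measureReal_union hdisj (measurableSet_hat T)]
  · simp only
    congr 1
    have h1 : (hat ((g * ·) ⁻¹' S) ∩ B : Set (Ultrafilter G)) =ᵐ[μ]
        (g • ·) ⁻¹' (hat S ∩ B) := by
      rw [Set.preimage_inter, preimage_smul_hat]
      exact (EventuallyEq.refl _ _).inter (hinv g).symm
    rw [measureReal_congr h1]
    exact (measurePreserving_smul g μ).measureReal_preimage
      ((measurableSet_hat S).inter hB).nullMeasurableSet

/-- The measure of an extreme invariant charge is ergodic. -/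
lemma ergodicSMul (hν : ν ∈ (invariantCharges G).extremePoints ℝ)
    (hμ : ∀ S, μ (hat S) = ENNReal.ofReal (ν S)) : ErgodicSMul G (Ultrafilter G) μ := by
  have hprob := isProbabilityMeasure hν.1 hμ
  have hsmul := smulInvariantMeasure hν.1 hμ
  refine { hsmul with aeconst_of_forall_preimage_smul_ae_eq := fun {B} hB hinv => ?_ }
  rw [eventuallyConst_set']
  by_cases hB0 : μ.real B = 0
  · left
    rwa [ae_eq_empty, ← measureReal_eq_zero_iff]
  by_cases hB1 : μ.real Bᶜ = 0
  · right
    rwa [ae_eq_univ, ← measureReal_eq_zero_iff]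
  exfalso
  have hcompl := probReal_add_probReal_compl (μ := μ) hB
  have hmem := cond_mem hB hB0 hinv
  have hmem' := cond_mem hB.compl hB1 fun g => (hinv g).compl
  -- `ν` is the average of its conditionings on `B` and `Bᶜ`, so extremality makes the conditioning
  -- on `B` equal to `ν`.
  have heq := hν.2 hmem hmem' ⟨μ.real B, μ.real Bᶜ, by positivity, by positivity, hcompl, by
    ext S
    simp only [Pi.add_apply, Pi.smul_apply, smul_eq_mul]
    rw [mul_inv_cancel_left₀ hB0, mul_inv_cancel_left₀ hB1, ← measureReal_hat hν.1 hμ S,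
      ← Set.sdiff_eq, measureReal_inter_add_sdiff hB]⟩
  -- Thus `B` is independent of every measurable set; testing on `Bᶜ` gives `μ B * μ Bᶜ = 0`.
  have hrestrict : μ.restrict B = μ B • μ := by
    refine measure_ext_hat fun S => ?_
    have hS : (μ.real B)⁻¹ * μ.real (hat S ∩ B) = ν S := congrFun heq S
    rw [inv_mul_eq_iff_eq_mul₀ hB0, ← measureReal_hat hν.1 hμ S] at hS
    rw [Measure.restrict_apply (measurableSet_hat S), Measure.smul_apply, smul_eq_mul,
      ← ENNReal.toReal_eq_toReal_iff' (by finiteness) (by finiteness), ENNReal.toReal_mul]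
    exact hS
  have hBc : (μ.restrict B).real Bᶜ = 0 := by
    rw [measureReal_restrict_apply hB.compl]; simp
  rw [hrestrict, measureReal_def, Measure.smul_apply, smul_eq_mul, ENNReal.toReal_mul] at hBc
  exact mul_ne_zero hB0 hB1 hBc

end Measure

end invariantCharges

/-! ### Means obtained by integrating over ultrafilters -/

namespace EllInfty

variable {G : Type*}

/-- The extension of a bounded function to the space of ultrafilters, by taking limits. -/
noncomputable def extension (f : EllInfty G) (U : Ultrafilter G) : ℂ := limUnder U f

/-- The values of `f` lie in a compact ball, so the limit exists and `limUnder` never takes its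
default value. -/
lemma tendsto_extension (f : EllInfty G) (U : Ultrafilter G) :
    Tendsto f U (𝓝 (extension f U)) := by
  have hmem : (Metric.closedBall (0 : ℂ) ‖f‖) ∈ U.map f :=
    Ultrafilter.mem_map.2 <| univ_mem' fun x => by
      simpa using lp.norm_apply_le_norm ENNReal.top_ne_zero f x
  obtain ⟨z, -, hz⟩ := (isCompact_closedBall (0 : ℂ) ‖f‖).ultrafilter_le_nhds' _ hmem
  exact tendsto_nhds_limUnder ⟨z, hz⟩

lemma extension_eq {f : EllInfty G} {U : Ultrafilter G} {z : ℂ} (h : Tendsto f U (𝓝 z)) :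
    extension f U = z :=
  tendsto_nhds_unique (tendsto_extension f U) h

lemma norm_extension_le (f : EllInfty G) (U : Ultrafilter G) : ‖extension f U‖ ≤ ‖f‖ :=
  le_of_tendsto (tendsto_extension f U).norm
    (Eventually.of_forall fun x => lp.norm_apply_le_norm ENNReal.top_ne_zero f x)

lemma measurable_extension (f : EllInfty G) : Measurable (extension f) := by
  have hre : Measurable fun U => (extension f U).re := measurable_of_tendsto
    fun U => (Complex.continuous_re.tendsto _).comp (tendsto_extension f U)
  have him : Measurable fun U => (extension f U).im := measurable_of_tendsto
    fun U => (Complex.continuous_im.tendsto _).comp (tendsto_extension f U)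
  have := (Complex.measurable_ofReal.comp hre).add
    ((Complex.measurable_ofReal.comp him).mul_const Complex.I)
  convert this using 1
  ext U
  simp

lemma integrable_extension (μ : Measure (Ultrafilter G)) [IsFiniteMeasure μ] (f : EllInfty G) :
    Integrable (extension f) μ :=
  Integrable.of_bound (measurable_extension f).aestronglyMeasurable ‖f‖
    (ae_of_all _ (norm_extension_le f))

lemma extension_add (f g : EllInfty G) (U : Ultrafilter G) :
    extension (f + g) U = extension f U + extension g U :=
  extension_eq ((tendsto_extension f U).add (tendsto_extension g U))

lemma extension_smul (c : ℂ) (f : EllInfty G) (U : Ultrafilter G) :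
    extension (c • f) U = c • extension f U :=
  extension_eq ((tendsto_extension f U).const_smul c)

lemma extension_leftTranslate [Semigroup G] (g : G) (f : EllInfty G) (U : Ultrafilter G) :
    extension (leftTranslate g f) U = extension f (g • U) :=
  extension_eq ((tendsto_extension f (g • U)).comp
    (tendsto_map : Tendsto (g * ·) (U : Filter G) _))

lemma indicator_apply (S : Set G) (x : G) :
    indicator S x = S.indicator (fun _ => (1 : ℂ)) x := rfl

lemma extension_indicator (S : Set G) :
    extension (indicator S) = (hat S).indicator fun _ => (1 : ℂ) := by
  ext U
  apply extension_eq
  by_cases hU : S ∈ U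
  · rw [Set.indicator_of_mem (by exact hU)]
    refine tendsto_const_nhds.congr' ?_
    filter_upwards [hU] with x hx
    rw [indicator_apply, Set.indicator_of_mem hx]
  · rw [Set.indicator_of_notMem (by exact hU)]
    refine tendsto_const_nhds.congr' ?_
    filter_upwards [compl_mem_iff_notMem.2 hU] with x hx
    rw [indicator_apply, Set.indicator_of_notMem hx]

/-- Integration of the extension of a bounded function against a probability measure on the
space of ultrafilters. -/
noncomputable def integralExtension (μ : Measure (Ultrafilter G)) [IsProbabilityMeasure μ] :
    EllInfty G →L[ℂ] ℂ :=
  LinearMap.mkContinuous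
    { toFun f := ∫ U, extension f U ∂μ
      map_add' f g := by
        simp only [extension_add]
        exact integral_add (integrable_extension μ f) (integrable_extension μ g)
      map_smul' c f := by
        simp only [extension_smul, integral_smul, RingHom.id_apply] } 1 fun f => by
    simpa using norm_integral_le_of_norm_le_const (μ := μ) (ae_of_all _ (norm_extension_le f))

lemma integralExtension_apply (μ : Measure (Ultrafilter G)) [IsProbabilityMeasure μ]
    (f : EllInfty G) : integralExtension μ f = ∫ U, extension f U ∂μ := rfl

lemma integralExtension_indicator (μ : Measure (Ultrafilter G)) [IsProbabilityMeasure μ]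
    (S : Set G) : integralExtension μ (indicator S) = (μ.real (hat S) : ℂ) := by
  rw [integralExtension_apply, extension_indicator, integral_indicator (measurableSet_hat S)]
  simp

lemma isLeftInvariantMean_integralExtension [Semigroup G] (μ : Measure (Ultrafilter G))
    [IsProbabilityMeasure μ] [SMulInvariantMeasure G (Ultrafilter G) μ] :
    IsLeftInvariantMean (integralExtension μ) where
  invariant g f := by
    simp only [integralExtension_apply, extension_leftTranslate]
    have hmp := measurePreserving_smul g μ
    rw [← integral_map hmp.measurable.aemeasurable
      (measurable_extension f).aestronglyMeasurable, hmp.map_eq]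
  nonneg f hf := by
    rw [integralExtension_apply]
    exact integral_nonneg fun U => ge_of_tendsto' (tendsto_extension f U) hf
  normalized := by rw [integralExtension_indicator]; simp

lemma leftTranslate_indicator [Semigroup G] (g : G) (S : Set G) :
    leftTranslate g (indicator S) = indicator ((g * ·) ⁻¹' S) := rfl

lemma indicator_union {S T : Set G} (h : Disjoint S T) :
    indicator (S ∪ T) = indicator S + indicator T := by
  ext x
  exact congrFun (Set.indicator_union_of_disjoint h fun _ => (1 : ℂ)) x

end EllInfty

/-! ### From means to charges, and the conclusion -/

namespace IsLeftInvariantMean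

variable {G : Type*} [Semigroup G] {m : EllInfty G →L[ℂ] ℂ}

lemma indicator_nonneg (hm : IsLeftInvariantMean m) (S : Set G) :
    0 ≤ m (EllInfty.indicator S) :=
  hm.nonneg _ fun x => by
    rw [EllInfty.indicator_apply]
    exact Set.indicator_nonneg (fun _ _ => zero_le_one) x

lemma re_indicator_mem (hm : IsLeftInvariantMean m) :
    (fun S => (m (EllInfty.indicator S)).re) ∈ invariantCharges G := by
  refine ⟨fun S => (Complex.nonneg_iff.1 (hm.indicator_nonneg S)).1, by simp [hm.normalized],
    fun S T h => by simp [EllInfty.indicator_union h], fun g S => ?_⟩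
  simp only
  rw [← EllInfty.leftTranslate_indicator, hm.invariant]

end IsLeftInvariantMean

theorem theorem6p10 {G : Type u} [Semigroup G] (E : Set G)
    (m : EllInfty G →L[ℂ] ℂ) (hm : IsLeftInvariantMean m)
    (hE : 0 < m (EllInfty.indicator E)) :
    ∃ m' : EllInfty G →L[ℂ] ℂ, IsLeftInvariantMean m' ∧
      m (EllInfty.indicator E) ≤ m' (EllInfty.indicator E) ∧
      ∃ (X : Type u) (_ : MeasurableSpace X) (_ : SemigroupAction G X)
        (μ : MeasureTheory.Measure X),
        MeasureTheory.IsProbabilityMeasure μ ∧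
        -- an identity element of `G`, if there is one, acts as the identity map
        (∀ e : G, (∀ g : G, e * g = g ∧ g * e = g) → ∀ x : X, e • x = x) ∧
        -- every `T_g` is measurable, preserves `μ`, and the action is ergodic
        MeasurableConstSMul G X ∧
        ErgodicSMul G X μ ∧
        ∃ A : Set X, MeasurableSet A ∧
          0 < μ.real A ∧
          (μ.real A : ℂ) = m' (EllInfty.indicator E) ∧
          ∀ c : StarExpr G,
            m' (EllInfty.indicator (c.eval (fun g x => g * x) E)) =
              (μ.real (c.eval (fun (g : G) (x : X) => g • x) A) : ℂ) := by
  obtain ⟨ν, hν, hle⟩ := invariantCharges.exists_extremePoint_le hm.re_indicator_mem E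
  obtain ⟨μ, hμ⟩ := invariantCharges.exists_measure hν.1
  have hprob := invariantCharges.isProbabilityMeasure hν.1 hμ
  have herg := invariantCharges.ergodicSMul hν hμ
  have hE' := Complex.pos_iff.1 hE
  have hμE := invariantCharges.measureReal_hat hν.1 hμ E
  refine ⟨EllInfty.integralExtension μ, EllInfty.isLeftInvariantMean_integralExtension μ, ?_,
    Ultrafilter G, inferInstance, inferInstance, μ, hprob, fun e he U => ?_, inferInstance, herg,
    hat E, measurableSet_hat E, ?_, (EllInfty.integralExtension_indicator μ E).symm, fun c => ?_⟩
  · rw [EllInfty.integralExtension_indicator, hμE, Complex.le_def]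
    exact ⟨hle, by simpa using hE'.2.symm⟩
  -- Only the left identity law matters, since the action pushes forward along left translation.
  · have hid : (e * ·) = (id : G → G) := funext fun g => (he g).1
    rw [smul_def, hid, Ultrafilter.map_id]
  · rw [hμE]
    exact hE'.1.trans_le hle
  · rw [EllInfty.integralExtension_indicator, hat_eval]
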